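/- **Theorem.** For a finite set $S$ of positive integers define the outcome function by $o(x)=\max\{s-o(x-s) : s\in S,\ s\le x\}$ for integers $x\ge\min S$, and $o(x)=0$ for $0\le x<\min S$. For $x\ge \min S$ let $\mathrm{opt}(x)$ be the largest $s\in S$ with $s\le x$ and $o(x)=s-o(x-s)$. The game $S$ converges at $\xi(S)=x>0$ if $\mathrm{opt}(y)$ is constant for $y\ge x$ and $\mathrm{opt}(x-1)$ is different from this constant. Let $m\ge 3$. For $1\le a\le m-1$ consider the truncated support game $S=\{a,a+1,\ldots,m\}$, and let $\mathrm{tr}^m_a=j$ be the positive integer with $\xi(S)\in\{2(j-1)m,\ldots,2jm\}$. Let $x^m_1<x^m_2<\cdots<x^m_k$ be the distinct values in the sequence $(\mathrm{tr}^m_a)_{a=1}^{m-1}$, with first differences $\Delta^m_i=x^m_{i+1}-x^m_i$ ($1\le i\le k-1$) and multiplicities $M_i=\#\{a\in\{1,\ldots,m-1\} : \mathrm{tr}^m_a=x^m_i\}$. Then: * for every $1\le a\le m-1$, the game converges and $\mathrm{tr}^m_a$ is well defined (exactly one such $j$ exists); * $\mathrm{tr}^m_a=2$ for every $a\in\{2,\ldots,\lceil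 m/2\rceil\}$; * $k\ge 2$, and the last first difference satisfies $$\Delta^m_{k-1}=\mathrm{tr}^m_{m-1}-\mathrm{tr}^m_{m-2}=\left\lfloor\frac{m-1}{2}\right\rfloor=\#\{a\in\{1,\ldots,m-1\} : \mathrm{tr}^m_a=2\}=M_2 .$$ -/

import Mathlib

namespace CumulativeSubtraction

/-- The legal (positive) actions of the action set `S` from a heap of `x` pebbles. -/
def moves (S : Finset ℕ) (x : ℕ) : Finset ℕ := S.filter fun s => 0 < s ∧ s ≤ x

/-- The outcome `o(x)` of the cumulative subtraction game `(S, x)`: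
`o(x) = max {s - o(x - s)}` over the legal actions `s`, and `o(x) = 0` at terminal positions. -/
def outcome (S : Finset ℕ) (x : ℕ) : ℤ :=
  if h : (moves S x).attach.Nonempty then
    (moves S x).attach.sup' h fun s => (s.1 : ℤ) - outcome S (x - s.1)
  else 0
termination_by x
decreasing_by
  have hs := (Finset.mem_filter.mp s.2).2
  omega

theorem outcome_of_nonempty (S : Finset ℕ) (x : ℕ) (h : (moves S x).Nonempty) :
    outcome S x = (moves S x).sup' h fun s => (s : ℤ) - outcome S (x - s) := by
  rw [outcome, dif_pos (Finset.attach_nonempty_iff.mpr h)]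
  apply le_antisymm
  · apply Finset.sup'_le
    intro s _
    exact Finset.le_sup' (fun s : ℕ => (s : ℤ) - outcome S (x - s)) s.2
  · apply Finset.sup'_le
    intro s hs
    exact Finset.le_sup' (fun s : {s // s ∈ moves S x} => (s.1 : ℤ) - outcome S (x - s.1))
      (Finset.mem_attach _ ⟨s, hs⟩)

theorem outcome_of_empty (S : Finset ℕ) (x : ℕ) (h : moves S x = ∅) : outcome S x = 0 := by
  rw [outcome, dif_neg (by simp [h])]

/-- The largest legal action `s` with `o(x) = s - o(x - s)`.
The value is `0`, which is never an action, when `x` is terminal. -/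
def opt (S : Finset ℕ) (x : ℕ) : ℕ :=
  ((moves S x).filter fun s : ℕ => outcome S x = (s : ℤ) - outcome S (x - s)).sup id

/-- The game `S` converges at position `x`, that is, `ξ(S) = x`: the optimal action is constant
from `x` on, and the optimal action at `x - 1` is not that constant. -/
def ConvergesAt (S : Finset ℕ) (x : ℕ) : Prop :=
  0 < x ∧ ∃ s ∈ S, (∀ y, x ≤ y → opt S y = s) ∧ opt S (x - 1) ≠ s

/-- For the truncated support game `S = {a, a + 1, …, m}`, the position `ξ(S)` exists and lies in
the `j`-th interval `{2(j-1)m, …, 2jm}`, where `j ≥ 1`. -/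
def IsConvergenceInterval (m a j : ℕ) : Prop :=
  1 ≤ j ∧ ∃ x, ConvergesAt (Finset.Icc a m) x ∧ 2 * (j - 1) * m ≤ x ∧ x ≤ 2 * j * m

/-- The convergence interval `tr^m_a`. -/
noncomputable def tr (m a : ℕ) : ℕ := sInf {j | IsConvergenceInterval m a j}

/-- The set `x^m = {tr^m_a | 1 ≤ a ≤ m - 1}`. -/
noncomputable def trValues (m : ℕ) : Finset ℕ := (Finset.Icc 1 (m - 1)).image (tr m)

/-- `x^m_j`, the `j`-th smallest element of `x^m`, for `1 ≤ j ≤ #x^m`. -/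
noncomputable def trValue (m j : ℕ) : ℕ := Nat.nth (fun v => v ∈ trValues m) (j - 1)

/-- The first difference `Δ^m_j = x^m_{j+1} - x^m_j`, for `1 ≤ j ≤ #x^m - 1`. -/
noncomputable def firstDiff (m j : ℕ) : ℤ := (trValue m (j + 1) : ℤ) - (trValue m j : ℤ)

/-- The multiplicity `M_j = #{a | tr^m_a = x^m_j}`, for `1 ≤ j ≤ #x^m`. -/
noncomputable def multiplicity (m j : ℕ) : ℕ :=
  ((Finset.Icc 1 (m - 1)).filter fun a => tr m a = trValue m j).card

end CumulativeSubtraction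

namespace CumulativeSubtraction

/-! Cut the heaps into blocks of length 2m. In block i the outcome depends only on the offset r and
z_i = max(0, a - i(m-a)): it is 0 below z_i, then r up to m, stays m while r < m + z_i, then falls
as 2m - r (`outcome_and_opt_Icc`, by strong induction). In block i+1 the optimal action differs from
m only for positive r with z_{i+1} ≤ r < z_i. So for a ≥ 2 play settles at offset z_q of block q+1,
where q = ⌊(a-2)/(m-a)⌋ is the last index with z_q ≥ 2 (`convergesAt_Icc`). Hence `tr m a` is q + 2,
and `tr m 1` is 1. This is monotone in a. Its last two values are m - 1 and ⌊m/2⌋, and it equals 2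
exactly for 2 ≤ a ≤ ⌊(m+1)/2⌋; the gap and the count are both ⌊(m-1)/2⌋. -/

theorem outcome_and_opt_of_best {S : Finset ℕ} {x s : ℕ} (hs : s ∈ moves S x)
    (hle : ∀ t ∈ moves S x, (t : ℤ) - outcome S (x - t) ≤ s - outcome S (x - s))
    (hlt : ∀ t ∈ moves S x, s < t → (t : ℤ) - outcome S (x - t) ≠ s - outcome S (x - s)) :
    outcome S x = s - outcome S (x - s) ∧ opt S x = s := by
  have ho : outcome S x = s - outcome S (x - s) := by
    rw [outcome_of_nonempty S x ⟨s, hs⟩]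
    exact le_antisymm (Finset.sup'_le _ _ hle)
      (Finset.le_sup' (fun t : ℕ => (t : ℤ) - outcome S (x - t)) hs)
  refine ⟨ho, le_antisymm (Finset.sup_le fun t ht => ?_) ?_⟩
  · rw [Finset.mem_filter] at ht
    by_contra hst
    exact hlt t ht.1 (not_le.mp hst) (ht.2.symm.trans ho)
  · exact Finset.le_sup (f := id) (Finset.mem_filter.mpr ⟨hs, ho⟩)

/-! ### Outcomes and optimal actions, block by block -/

/-- In the `i`-th block of `2m` heaps, the offset of the first nonzero outcome. -/
def threshold (m a i : ℕ) : ℕ := a - i * (m - a)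

theorem threshold_succ (m a i : ℕ) :
    threshold m a (i + 1) = threshold m a i - (m - a) := by
  unfold threshold
  rw [add_mul, one_mul, Nat.sub_add_eq]

/-- The outcome at offset `r < 2m` of a block with threshold `z`. -/
def blockOutcome (m z r : ℕ) : ℤ :=
  if r ≤ m then (if z ≤ r then r else 0) else if r < m + z then m else 2 * m - r

/-- The optimal action at offset `r < 2m` of the `i`-th block. -/
def blockOpt (m a : ℕ) : ℕ → ℕ → ℕ
  | 0, r => if r < a then 0 else min r m
  | i + 1, r => if r = 0 ∨ r < threshold m a (i + 1) then m else min m (m + r - threshold m a i)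

theorem mem_moves_Icc {a m x t : ℕ} :
    t ∈ moves (Finset.Icc a m) x ↔ a ≤ t ∧ t ≤ m ∧ 0 < t ∧ t ≤ x := by
  simp [moves, and_assoc]

/-- The outcome after the action `t` at offset `r` of a block with threshold `z'`, when the previous
block has threshold `z`. -/
def moveOutcome (m z z' r t : ℕ) : ℤ :=
  if t ≤ r then blockOutcome m z' (r - t) else blockOutcome m z (2 * m + r - t)

theorem sub_moveOutcome_le {m a z z' r t : ℕ} (hat : a ≤ t) (htm : t ≤ m) (ht : 0 < t)
    (hr : r < 2 * m) (hz : z' = z - (m - a)) (hza : z ≤ a) :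
    (t : ℤ) - moveOutcome m z z' r t ≤ blockOutcome m z' r := by
  unfold moveOutcome blockOutcome
  by_cases h : t ≤ r
  · rw [if_pos h]
    split_ifs <;> omega
  · rw [if_neg h]
    split_ifs <;> omega

/-- For z' ≤ r < z with r > 0, the action m + r - z lands at offset m + z of the previous block,
where the plateau at m ends, and nets r. It is legal because it is at least a exactly when r ≥ z -
(m-a), which is how the threshold drops by m - a per block. -/
theorem sub_moveOutcome_blockOpt {m a i r : ℕ} (ha : 1 ≤ a) (ham : a < m) (hr : r < 2 * m) :
    (blockOpt m a (i + 1) r : ℤ) -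
      moveOutcome m (threshold m a i) (threshold m a (i + 1)) r (blockOpt m a (i + 1) r) =
    blockOutcome m (threshold m a (i + 1)) r := by
  have hz := threshold_succ m a i
  have hza : threshold m a i ≤ a := Nat.sub_le _ _
  simp only [blockOpt]
  generalize threshold m a (i + 1) = z' at *
  generalize threshold m a i = z at *
  by_cases h : r = 0 ∨ r < z'
  · rw [if_pos h]
    unfold moveOutcome blockOutcome
    split_ifs <;> omega
  · rw [if_neg h]
    unfold moveOutcome blockOutcome
    rcases le_total m (m + r - z) with h' | h'
    · rw [min_eq_left h']
      split_ifs <;> omega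
    · rw [min_eq_right h']
      split_ifs <;> omega

theorem sub_moveOutcome_ne {m a i r t : ℕ} (ha : 1 ≤ a) (ham : a < m) (hr : r < 2 * m)
    (htm : t ≤ m) (ht : blockOpt m a (i + 1) r < t) :
    (t : ℤ) - moveOutcome m (threshold m a i) (threshold m a (i + 1)) r t ≠
    blockOutcome m (threshold m a (i + 1)) r := by
  have hz := threshold_succ m a i
  have hza : threshold m a i ≤ a := Nat.sub_le _ _
  simp only [blockOpt] at ht
  generalize threshold m a (i + 1) = z' at *
  generalize threshold m a i = z at *
  by_cases h : r = 0 ∨ r < z'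
  · rw [if_pos h] at ht
    omega
  · rw [if_neg h] at ht
    unfold moveOutcome blockOutcome
    split_ifs <;> omega

theorem outcome_and_opt_Icc {m a : ℕ} (ha : 1 ≤ a) (ham : a < m) (x : ℕ) :
    ∀ i r, x = 2 * m * i + r → r < 2 * m →
      outcome (Finset.Icc a m) x = blockOutcome m (threshold m a i) r ∧
      opt (Finset.Icc a m) x = blockOpt m a i r := by
  induction x using Nat.strong_induction_on with
  | _ x ih =>
  intro i r hx hr
  have same : ∀ t, 0 < t → t ≤ r →
      outcome (Finset.Icc a m) (x - t) = blockOutcome m (threshold m a i) (r - t) := fun t h0 h1 =>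
    (ih (x - t) (by omega) i (r - t) (by omega) (by omega)).1
  cases i with
  | zero =>
    have hz : threshold m a 0 = a := by simp [threshold]
    simp only [hz, blockOpt] at same ⊢
    by_cases hra : r < a
    · have he : moves (Finset.Icc a m) x = ∅ := by
        ext t
        simp only [mem_moves_Icc, Finset.notMem_empty, iff_false]
        omega
      rw [outcome_of_empty _ _ he, opt, he]
      simp only [blockOutcome]
      constructor
      · split_ifs <;> omega
      · simp [hra]
    · have key := outcome_and_opt_of_best (S := Finset.Icc a m) (x := x) (s := min r m)
        (mem_moves_Icc.mpr (by omega)) (fun t ht => ?_) (fun t ht hlt => ?_)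
      · rw [same _ (by omega) (by omega)] at key
        refine ⟨key.1.trans ?_, by rw [key.2, if_neg hra]⟩
        unfold blockOutcome
        split_ifs <;> omega
      · rw [mem_moves_Icc] at ht
        rw [same _ (by omega) (by omega), same _ (by omega) (by omega)]
        unfold blockOutcome
        split_ifs <;> omega
      · rw [mem_moves_Icc] at ht
        omega
  | succ i =>
    have hxi : x = 2 * m * i + (2 * m + r) := by rw [hx]; ring
    -- An action larger than the offset reaches back only one block, since t ≤ m.
    have prev : ∀ t, 0 < t → t ≤ m → r < t →
        outcome (Finset.Icc a m) (x - t) = blockOutcome m (threshold m a i) (2 * m + r - t) :=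
      fun t h0 h1 h2 => (ih (x - t) (by omega) i (2 * m + r - t) (by omega) (by omega)).1
    have hz := threshold_succ m a i
    have hza : threshold m a i ≤ a := Nat.sub_le _ _
    have val : ∀ t, 0 < t → t ≤ m → outcome (Finset.Icc a m) (x - t) =
        moveOutcome m (threshold m a i) (threshold m a (i + 1)) r t := by
      intro t h0 h1
      unfold moveOutcome
      split_ifs with h
      · exact same t h0 h
      · exact prev t h0 h1 (by omega)
    have key := outcome_and_opt_of_best (S := Finset.Icc a m) (x := x) (s := blockOpt m a (i + 1) r)
    have hb : a ≤ blockOpt m a (i + 1) r ∧ blockOpt m a (i + 1) r ≤ m := by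
      simp only [blockOpt]; split_ifs <;> omega
    have hval := sub_moveOutcome_blockOpt (m := m) (i := i) ha ham hr
    rw [← val _ (by omega) hb.2] at hval
    rw [hval] at key
    refine key (mem_moves_Icc.mpr (by omega)) (fun t ht => ?_) (fun t ht hlt => ?_)
    · rw [mem_moves_Icc] at ht
      rw [val t (by omega) ht.2.1]
      exact sub_moveOutcome_le ht.1 ht.2.1 (by omega) hr hz hza
    · rw [mem_moves_Icc] at ht
      rw [val t (by omega) ht.2.1]
      exact sub_moveOutcome_ne ha ham hr ht.2.1 hlt

theorem opt_Icc {m a : ℕ} (ha : 1 ≤ a) (ham : a < m) (i r : ℕ) (hr : r < 2 * m) :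
    opt (Finset.Icc a m) (2 * m * i + r) = blockOpt m a i r :=
  (outcome_and_opt_Icc ha ham _ i r rfl hr).2

/-! ### The convergence position -/

theorem ConvergesAt.unique {S : Finset ℕ} {x y : ℕ} (hx : ConvergesAt S x)
    (hy : ConvergesAt S y) : x = y := by
  obtain ⟨hx0, s, -, hs, hs'⟩ := hx
  obtain ⟨hy0, t, -, ht, ht'⟩ := hy
  have hst : s = t := (hs (max x y) (le_max_left _ _)).symm.trans (ht _ (le_max_right _ _))
  subst hst
  rcases lt_trichotomy x y with h | h | h
  · exact absurd (hs (y - 1) (by omega)) ht'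
  · exact h
  · exact absurd (ht (x - 1) (by omega)) hs'

theorem convergesAt_Icc_one {m : ℕ} (hm : 2 ≤ m) : ConvergesAt (Finset.Icc 1 m) m := by
  refine ⟨by omega, m, by simp; omega, fun y hy => ?_, ?_⟩
  · obtain ⟨i, r, hr, rfl⟩ : ∃ i r, r < 2 * m ∧ y = 2 * m * i + r :=
      ⟨y / (2 * m), y % (2 * m), Nat.mod_lt _ (by omega), (Nat.div_add_mod _ _).symm⟩
    rw [opt_Icc le_rfl (by omega) _ _ hr]
    cases i with
    | zero => simp only [blockOpt]; split_ifs <;> omega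
    | succ i =>
      have : threshold m 1 i ≤ 1 := Nat.sub_le _ _
      simp only [blockOpt]; split_ifs <;> omega
  · have h := opt_Icc (m := m) le_rfl (by omega) 0 (m - 1) (by omega)
    rw [mul_zero, zero_add] at h
    rw [h, blockOpt]
    split_ifs <;> omega

theorem convergesAt_Icc {m a : ℕ} (ha : 2 ≤ a) (ham : a < m) :
    ConvergesAt (Finset.Icc a m)
      (2 * m * ((a - 2) / (m - a) + 1) + threshold m a ((a - 2) / (m - a))) := by
  have hq1 : (a - 2) / (m - a) * (m - a) ≤ a - 2 := Nat.div_mul_le_self _ _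
  have hq2 : a - 2 < ((a - 2) / (m - a) + 1) * (m - a) :=
    Nat.lt_mul_of_div_lt (by omega) (by omega)
  generalize (a - 2) / (m - a) = q at *
  have hz2 : 2 ≤ threshold m a q := by unfold threshold; omega
  have hza : threshold m a q ≤ a := Nat.sub_le _ _
  have hz1 : threshold m a (q + 1) ≤ 1 := by unfold threshold; omega
  refine ⟨by omega, m, by simp; omega, fun y hy => ?_, ?_⟩
  · obtain ⟨i, r, hr, rfl⟩ : ∃ i r, r < 2 * m ∧ y = 2 * m * i + r :=
      ⟨y / (2 * m), y % (2 * m), Nat.mod_lt _ (by omega), (Nat.div_add_mod _ _).symm⟩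
    have hqi : q + 1 ≤ i := by
      by_contra h
      have := Nat.mul_le_mul_left (2 * m) (show i + 1 ≤ q + 1 by omega)
      rw [mul_add _ i, mul_one] at this
      omega
    rw [opt_Icc (by omega) ham _ _ hr]
    obtain ⟨i, rfl⟩ : ∃ k, i = k + 1 := ⟨i - 1, by omega⟩
    simp only [blockOpt]
    rcases eq_or_lt_of_le hqi with h | h
    · obtain rfl : q = i := by omega
      split_ifs <;> omega
    · have : threshold m a i ≤ threshold m a (q + 1) :=
        Nat.sub_le_sub_left (Nat.mul_le_mul_right _ (by omega)) _
      split_ifs <;> omega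
  -- At offset z_q - 1, which is positive and at least z_{q+1}, the optimal action is m - 1.
  · rw [Nat.add_sub_assoc (by omega), opt_Icc (by omega) ham _ _ (by omega), blockOpt]
    have := threshold_succ m a q
    split_ifs <;> omega

/-! ### The convergence interval -/

/-- Adjacent closed intervals share endpoints, so uniqueness of j needs the position strictly
inside. -/
theorem isConvergenceInterval_iff {m a x j : ℕ} (hx : ConvergesAt (Finset.Icc a m) x)
    {q : ℕ} (h1 : 2 * m * q < x) (h2 : x < 2 * m * (q + 1)) :
    IsConvergenceInterval m a j ↔ j = q + 1 := by
  constructor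
  · rintro ⟨hj, y, hy, hy1, hy2⟩
    obtain rfl := hx.unique hy
    obtain ⟨k, rfl⟩ : ∃ k, j = k + 1 := ⟨j - 1, by omega⟩
    simp only [Nat.add_sub_cancel] at hy1
    have hk : k < q + 1 := by
      refine Nat.lt_of_mul_lt_mul_left (a := 2 * m) ?_
      calc 2 * m * k = 2 * k * m := by ring
        _ < _ := by omega
    have hk' : q < k + 1 := by
      refine Nat.lt_of_mul_lt_mul_left (a := 2 * m) ?_
      calc 2 * m * q < 2 * (k + 1) * m := by omega
        _ = _ := by ring
    omega
  · rintro rfl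
    refine ⟨by omega, x, hx, ?_, ?_⟩
    · rw [Nat.add_sub_cancel, mul_right_comm]; exact h1.le
    · rw [mul_right_comm]; exact h2.le

theorem isConvergenceInterval_one_iff {m j : ℕ} (hm : 2 ≤ m) :
    IsConvergenceInterval m 1 j ↔ j = 1 :=
  isConvergenceInterval_iff (q := 0) (convergesAt_Icc_one hm) (by omega) (by omega)

theorem isConvergenceInterval_iff_of_two_le {m a j : ℕ} (ha : 2 ≤ a) (ham : a < m) :
    IsConvergenceInterval m a j ↔ j = (a - 2) / (m - a) + 2 := by
  have hq1 : (a - 2) / (m - a) * (m - a) ≤ a - 2 := Nat.div_mul_le_self _ _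
  have hz2 : 2 ≤ threshold m a ((a - 2) / (m - a)) := by unfold threshold; omega
  have hza : threshold m a ((a - 2) / (m - a)) ≤ a := Nat.sub_le _ _
  refine isConvergenceInterval_iff (convergesAt_Icc ha ham) (by omega) ?_
  rw [mul_add _ (_ + 1) 1]
  omega

theorem tr_eq_of_iff {m a k : ℕ} (h : ∀ j, IsConvergenceInterval m a j ↔ j = k) :
    tr m a = k := by
  simp [tr, h]

theorem tr_one {m : ℕ} (hm : 2 ≤ m) : tr m 1 = 1 :=
  tr_eq_of_iff fun _ => isConvergenceInterval_one_iff hm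

theorem tr_of_two_le {m a : ℕ} (ha : 2 ≤ a) (ham : a < m) :
    tr m a = (a - 2) / (m - a) + 2 :=
  tr_eq_of_iff fun _ => isConvergenceInterval_iff_of_two_le ha ham

theorem tr_eq_two_iff {m a : ℕ} (hm : 3 ≤ m) (ha : 1 ≤ a) (ham : a < m) :
    tr m a = 2 ↔ 2 ≤ a ∧ a ≤ (m + 1) / 2 := by
  rcases ha.eq_or_lt with rfl | ha
  · simp [tr_one (show 2 ≤ m by omega)]
  · rw [tr_of_two_le ha ham, Nat.add_eq_right, Nat.div_eq_zero_iff]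
    omega

theorem tr_mono {m a b : ℕ} (hab : a ≤ b) (ha : 1 ≤ a) (hbm : b < m) : tr m a ≤ tr m b := by
  rcases ha.eq_or_lt with rfl | ha
  · rw [tr_one (by omega)]
    rcases hab.eq_or_lt with rfl | hb
    · rw [tr_one (by omega)]
    · rw [tr_of_two_le hb hbm]; exact Nat.le_add_left_of_le one_le_two
  · rw [tr_of_two_le ha (by omega), tr_of_two_le (by omega) hbm]
    exact Nat.add_le_add_right (Nat.div_le_div (by omega) (by omega) (by omega)) _

theorem tr_pred {m : ℕ} (hm : 3 ≤ m) : tr m (m - 1) = m - 1 := by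
  rw [tr_of_two_le (by omega) (by omega), show m - (m - 1) = 1 by omega, Nat.div_one]
  omega

theorem tr_pred_pred {m : ℕ} (hm : 3 ≤ m) : tr m (m - 2) = m / 2 := by
  -- For m = 3 the index m - 2 is 1, outside the range of the quotient formula.
  rcases hm.eq_or_lt with rfl | hm
  · exact tr_one (by omega)
  · rw [tr_of_two_le (by omega) (by omega), show m - (m - 2) = 2 by omega]
    omega

/-! ### The sorted list of distinct values -/

theorem mem_trValues {m v : ℕ} : v ∈ trValues m ↔ ∃ a, (1 ≤ a ∧ a ≤ m - 1) ∧ tr m a = v := by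
  simp [trValues]

theorem trValue_eq_of_card {m j v : ℕ} (hv : v ∈ trValues m)
    (hj : ((trValues m).filter (· < v)).card = j - 1) : trValue m j = v := by
  have hc : Nat.count (fun v => v ∈ trValues m) v = j - 1 := by
    rw [← hj, Nat.count_eq_card_filter_range]
    congr 1
    ext w
    simp [and_comm]
  rw [trValue, ← hc]
  exact Nat.nth_count (p := fun v => v ∈ trValues m) hv

theorem tr_mem_trValues {m a : ℕ} (ha : 1 ≤ a) (ham : a < m) : tr m a ∈ trValues m :=
  mem_trValues.mpr ⟨a, by omega, rfl⟩

theorem trValue_two {m : ℕ} (hm : 3 ≤ m) : trValue m 2 = 2 := by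
  have h2 : tr m 2 = 2 := (tr_eq_two_iff hm (by omega) (by omega)).mpr (by omega)
  refine trValue_eq_of_card (h2 ▸ tr_mem_trValues (by omega) (by omega)) ?_
  rw [Finset.card_eq_one]
  refine ⟨1, Finset.ext fun v => ?_⟩
  have h1 : tr m 1 = 1 := tr_one (by omega)
  simp only [Finset.mem_filter, Finset.mem_singleton]
  constructor
  · rintro ⟨hv, hv2⟩
    obtain ⟨a, ha, rfl⟩ := mem_trValues.mp hv
    have := tr_mono ha.1 le_rfl (show a < m by omega)
    omega
  · rintro rfl
    exact ⟨mem_trValues.mpr ⟨1, by omega, h1⟩, by omega⟩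

theorem trValue_card {m : ℕ} (hm : 3 ≤ m) : trValue m (trValues m).card = m - 1 := by
  have hmem : m - 1 ∈ trValues m := mem_trValues.mpr ⟨m - 1, by omega, tr_pred hm⟩
  refine trValue_eq_of_card hmem ?_
  rw [← Finset.card_erase_of_mem hmem]
  congr 1
  ext v
  simp only [Finset.mem_filter, Finset.mem_erase]
  constructor
  · rintro ⟨hv, hlt⟩
    exact ⟨hlt.ne, hv⟩
  · rintro ⟨hne, hv⟩
    refine ⟨hv, lt_of_le_of_ne ?_ hne⟩
    obtain ⟨a, ha, rfl⟩ := mem_trValues.mp hv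
    exact (tr_mono ha.2 ha.1 (by omega)).trans_eq (tr_pred hm)

theorem trValue_card_pred {m : ℕ} (hm : 3 ≤ m) :
    trValue m ((trValues m).card - 1) = m / 2 := by
  have hmem : m - 1 ∈ trValues m := mem_trValues.mpr ⟨m - 1, by omega, tr_pred hm⟩
  have hmem' : m / 2 ∈ trValues m := mem_trValues.mpr ⟨m - 2, by omega, tr_pred_pred hm⟩
  refine trValue_eq_of_card hmem' ?_
  -- By monotonicity, only m - 1 and m / 2 itself fail to lie below m / 2.
  rw [← Finset.card_erase_of_mem hmem, ← Finset.card_erase_of_mem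
    (Finset.mem_erase.mpr ⟨show m / 2 ≠ m - 1 by omega, hmem'⟩)]
  congr 1
  ext v
  simp only [Finset.mem_filter, Finset.mem_erase]
  constructor
  · rintro ⟨hv, hlt⟩
    exact ⟨hlt.ne, by omega, hv⟩
  · rintro ⟨hne, hne', hv⟩
    refine ⟨hv, lt_of_le_of_ne ?_ hne⟩
    obtain ⟨a, ha, rfl⟩ := mem_trValues.mp hv
    have ha' : a ≠ m - 1 := by
      rintro rfl
      exact hne' (tr_pred hm)
    exact (tr_mono (show a ≤ m - 2 by omega) ha.1 (by omega)).trans_eq (tr_pred_pred hm)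

theorem two_le_card_trValues {m : ℕ} (hm : 3 ≤ m) : 2 ≤ (trValues m).card := by
  refine Finset.one_lt_card.mpr ⟨m - 1, mem_trValues.mpr ⟨m - 1, by omega, tr_pred hm⟩,
    m / 2, mem_trValues.mpr ⟨m - 2, by omega, tr_pred_pred hm⟩, by omega⟩

theorem card_filter_tr_eq_two {m : ℕ} (hm : 3 ≤ m) :
    ((Finset.Icc 1 (m - 1)).filter fun a => tr m a = 2).card = (m - 1) / 2 := by
  have : ((Finset.Icc 1 (m - 1)).filter fun a => tr m a = 2) = Finset.Icc 2 ((m + 1) / 2) := by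
    ext a
    simp only [Finset.mem_filter, Finset.mem_Icc]
    constructor
    · rintro ⟨ha, h⟩
      exact (tr_eq_two_iff hm ha.1 (by omega)).mp h
    · intro h
      exact ⟨by omega, (tr_eq_two_iff hm (by omega) (by omega)).mpr h⟩
  rw [this, Nat.card_Icc]
  omega

theorem existsUnique_isConvergenceInterval {m a : ℕ} (ha : 1 ≤ a) (ham : a < m) :
    ∃! j, IsConvergenceInterval m a j := by
  rcases ha.eq_or_lt with rfl | ha
  · simp [isConvergenceInterval_one_iff (show 2 ≤ m by omega)]
  · simp [isConvergenceInterval_iff_of_two_le ha ham]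

theorem floor_pred_div_two {m : ℕ} (hm : 1 ≤ m) :
    ⌊((m : ℚ) - 1) / 2⌋ = (((m - 1) / 2 : ℕ) : ℤ) := by
  have h := Rat.floor_intCast_div_natCast (m - 1 : ℤ) 2
  push_cast at h
  rw [h]
  omega

end CumulativeSubtraction

theorem mainTheorem6 (m : ℕ) (hm : 3 ≤ m) :
    (∀ a ∈ Finset.Icc 1 (m - 1), ∃! j, CumulativeSubtraction.IsConvergenceInterval m a j) ∧
    (∀ a : ℕ, 2 ≤ a → a ≤ ⌈(m : ℚ) / 2⌉₊ → CumulativeSubtraction.tr m a = 2) ∧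
    2 ≤ (CumulativeSubtraction.trValues m).card ∧
    CumulativeSubtraction.firstDiff m ((CumulativeSubtraction.trValues m).card - 1) =
      (CumulativeSubtraction.tr m (m - 1) : ℤ) - (CumulativeSubtraction.tr m (m - 2) : ℤ) ∧
    (CumulativeSubtraction.tr m (m - 1) : ℤ) - (CumulativeSubtraction.tr m (m - 2) : ℤ) =
      ⌊((m : ℚ) - 1) / 2⌋ ∧
    ⌊((m : ℚ) - 1) / 2⌋ =
      (((Finset.Icc 1 (m - 1)).filter fun a => CumulativeSubtraction.tr m a = 2).card : ℤ) ∧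
    ((Finset.Icc 1 (m - 1)).filter fun a => CumulativeSubtraction.tr m a = 2).card =
      CumulativeSubtraction.multiplicity m 2 := by
  open CumulativeSubtraction in
  refine ⟨fun a ha => ?_, fun a ha ham => ?_, two_le_card_trValues hm, ?_, ?_, ?_, ?_⟩
  · rw [Finset.mem_Icc] at ha
    exact existsUnique_isConvergenceInterval ha.1 (by omega)
  · have h : a ≤ (m + 1) / 2 := by
      rw [Nat.le_div_iff_mul_le two_pos]
      by_contra hlt
      refine absurd ham (not_le.mpr ((Nat.ceil_le (n := a - 1)).mpr ?_ |>.trans_lt (by omega)))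
      rw [div_le_iff₀ two_pos]
      exact_mod_cast (show m ≤ (a - 1) * 2 by omega)
    exact (tr_eq_two_iff hm (by omega) (by omega)).mpr ⟨ha, h⟩
  · have h2 := two_le_card_trValues hm
    rw [firstDiff, Nat.sub_add_cancel (by omega), trValue_card hm, trValue_card_pred hm,
      tr_pred hm, tr_pred_pred hm]
  · rw [floor_pred_div_two (by omega), tr_pred hm, tr_pred_pred hm]
    omega
  · rw [floor_pred_div_two (by omega), card_filter_tr_eq_two hm]
  · rw [CumulativeSubtraction.multiplicity, trValue_two hm]
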